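/- A ring $R$ is called clean if every element of $R$ is the sum of a unit and an idempotent of $R$. For coprime positive integers $m,k$, let $\operatorname{ord}_m k$ denote the multiplicative order of $k$ modulo $m$ (so $\operatorname{ord}_1 k=1$), let $\varphi$ be Euler's function, and let $\exp(G)$ be the exponent of a finite group $G$. Let $K=\mathbb{Q}(\zeta_n)$ be a cyclotomic field for some positive integer $n$, where $\zeta_n$ is a primitive $n$th root of unity, let $\mathcal{O}=\mathbb{Z}[\zeta_n]$ be its ring of integers, let $\mathfrak{p}\subset\mathcal{O}$ be a nonzero prime ideal, with localization $\mathcal{O}_{\mathfrak p}$, and let $G$ be a finite abelian group. Let $p$ be the prime number with $p\mathbb{Z}=\mathfrak{p}\cap\mathbb{Z}$. Let $n_0$ be the largest positive divisor of $n$ with $p\nmid n_0$, let $n_1$ be the largest positive divisor of $\exp(G)$ with $p\nmid n_1$ and $\gcd(n_1,n_0)=1$, and let $m'$ be the largest positive divisor of the integer $\frac{\operatorname{lcm}(\exp(G),n_0)}{n_0n_1}$ with $p\nmid m'$. Then the group ring $\mathcal{O}_{\mathfrak p}[G]$ is clean if and only if the following three conditions all hold: $$\operatorname{ord}_{n_1}p=\varphi(n_1),\qquad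 \operatorname{ord}_{n_0m'}p=m'\operatorname{ord}_{n_0}p,\qquad \gcd(\operatorname{ord}_{n_1}p,\operatorname{ord}_{n_0m'}p)=1.$$ In particular, if $\exp(G)$ divides $n$, then $\mathcal{O}_{\mathfrak p}[G]$ is clean. -/

import Mathlib

/-- An element of a ring is clean if it is the sum of a unit and an idempotent. -/
def IsCleanElement {R : Type*} [Ring R] (a : R) : Prop :=
  ∃ u e : R, IsUnit u ∧ IsIdempotentElem e ∧ a = u + e

/-- A ring is clean if each of its elements is clean. -/
def IsCleanRing (R : Type*) [Ring R] : Prop :=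
  ∀ a : R, IsCleanElement a

/-- The multiplicative order of the integer `m` modulo `n`, that is, the least `k ≥ 1` with
`m ^ k ≡ 1` modulo `n`. It is only used for `m` coprime to `n ≥ 1`. -/
noncomputable def ordMod (n m : ℕ) : ℕ :=
  orderOf (m : ZMod n)

/-!
# Clean group rings over localizations of cyclotomic integers

Let `R` be the localization of the ring of integers of `K = ℚ(ζ_n)` at a prime above `p`, with
residue field `k`, and let `N` be the prime-to-`p` part of the exponent of `G`. The group ring
`R[G]` is clean if and only if `R[ζ_N]` is a local ring.

* `R[ζ_N]` is a quotient of `R[G]` through a suitable character of `G`. Quotients of clean rings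
  are clean, and a clean domain is local: `IsCleanRing.adjoin_of_monoidAlgebra`,
  `IsCleanRing.isLocalRing`.
* Conversely, suppose that `S = R[ζ_N]` is local. The maximal ideals of `S[G]` are the preimages
  of the maximal ideal of `S` under the characters of `G` of order dividing `N`. For `x` in
  `R[G]`, the sum `e` of the idempotents of those characters that send `x` into the maximal ideal
  makes `x - e` a unit, and both `e` and `(x - e)⁻¹` are Galois invariant, hence lie in `R[G]`:
  `isCleanRing_monoidAlgebra_of_isLocalRing`.

Next, `R[ζ_N] = R[X] / (P)`, with `P` the minimal polynomial of `ζ_N`, is local if and only if `P`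
remains irreducible over `k`, that is, if and only if `[K(ζ_N) : K] = [k(ζ_N) : k]`
(`isLocalRing_adjoin_iff_natDegree`). The left side is `φ(lcm(n, N)) / φ(n)`. The right side is
the order modulo `N` of `|k| = p ^ f`, where `f` is the order of `p` modulo `n₀`. Splitting
`lcm(N, n₀) = n₁ · (n₀ m')` into coprime factors turns the equality of the two degrees into the
three stated conditions: each order divides the corresponding totient expression, and equality
means that no factor is lost (`totient_lcm_eq_iff`).
-/

/-! ### Clean rings and local rings -/

theorem IsCleanRing.of_surjective {R S : Type*} [Ring R] [Ring S] (hR : IsCleanRing R)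
    (f : R →+* S) (hf : Function.Surjective f) : IsCleanRing S := by
  intro s
  obtain ⟨r, rfl⟩ := hf s
  obtain ⟨u, e, hu, he, rfl⟩ := hR r
  exact ⟨f u, f e, hu.map f, he.map f, map_add f u e⟩

/-- A domain has only the idempotents `0` and `1`, so cleanness says that `a` or `a - 1` is a unit
for every `a`. -/
theorem IsCleanRing.isLocalRing {R : Type*} [CommRing R] [IsDomain R] (hR : IsCleanRing R) :
    IsLocalRing R := by
  refine IsLocalRing.of_isUnit_or_isUnit_one_sub_self fun a => ?_
  obtain ⟨u, e, hu, he, rfl⟩ := hR a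
  rcases IsIdempotentElem.iff_eq_zero_or_one.mp he with rfl | rfl
  · left; simpa using hu
  · right; simpa using hu

/-! ### Characters with values in a local domain -/

section Characters

variable {S G : Type*} [CommRing S] [CommGroup G] {N : ℕ}

/-- The `S`-algebra homomorphism `S[G] → S` extending a character `χ` of `G` whose values are
`N`-th roots of unity. -/
noncomputable def charEval (χ : G →* rootsOfUnity N S) : MonoidAlgebra S G →ₐ[S] S :=
  MonoidAlgebra.lift S S G ((Units.coeHom S).comp ((rootsOfUnity N S).subtype.comp χ))

theorem charEval_single (χ : G →* rootsOfUnity N S) (g : G) (s : S) :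
    charEval χ (MonoidAlgebra.single g s) = s * ((χ g : Sˣ) : S) := by
  simp [charEval]

/-- A primitive `N`-th root of unity stays primitive under reduction as long as `N` is nonzero in
the target, being a root of the `N`-th cyclotomic polynomial. -/
theorem isPrimitiveRoot_map_of_natCast_ne_zero {F : Type*} [Field F] [IsDomain S] (f : S →+* F)
    {ζ : S} (hζ : IsPrimitiveRoot ζ N) (hN : (N : F) ≠ 0) : IsPrimitiveRoot (f ζ) N := by
  have : NeZero (N : F) := ⟨hN⟩
  have hS : NeZero (N : S) := ⟨fun h => hN (by simpa using congrArg f h)⟩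
  have h := (Polynomial.isRoot_cyclotomic_iff (R := S)).mpr hζ
  rw [← Polynomial.isRoot_cyclotomic_iff, ← Polynomial.map_cyclotomic N f]
  exact h.map


/-- Every maximal ideal of `S[G]` comes from a character: in the residue field `S[G] / M`, of
characteristic `p`, the elements of `G` become `N`-th roots of unity, and these lift uniquely to
`S`. -/
theorem exists_charEval_mem_of_mem_maximal [IsDomain S] [IsLocalRing S] [Finite G] {p a : ℕ}
    (hp : p.Prime) (hpN : ¬ p ∣ N) (hexp : Monoid.exponent G = p ^ a * N)
    (hpS : (p : S) ∈ IsLocalRing.maximalIdeal S) {ζ : S} (hζ : IsPrimitiveRoot ζ N)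
    (M : Ideal (MonoidAlgebra S G)) [M.IsMaximal] {x : MonoidAlgebra S G} (hx : x ∈ M) :
    ∃ χ : G →* rootsOfUnity N S, charEval χ x ∈ IsLocalRing.maximalIdeal S := by
  have hN0 : N ≠ 0 := fun h => hpN (h ▸ dvd_zero p)
  have : NeZero N := ⟨hN0⟩
  let _ : Field (MonoidAlgebra S G ⧸ M) := Ideal.Quotient.field M
  let π : MonoidAlgebra S G →+* MonoidAlgebra S G ⧸ M := Ideal.Quotient.mk M
  let f : S →+* MonoidAlgebra S G ⧸ M := π.comp (algebraMap S (MonoidAlgebra S G))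
  have hmax : (M.comap (algebraMap S (MonoidAlgebra S G))).IsMaximal :=
    Ideal.isMaximal_comap_of_isIntegral_of_isMaximal M
  have hker : ∀ s, s ∈ IsLocalRing.maximalIdeal S ↔ f s = 0 := by
    intro s
    rw [← IsLocalRing.eq_maximalIdeal hmax, Ideal.mem_comap, ← Ideal.Quotient.eq_zero_iff_mem]
    rfl
  have hp0 : (p : MonoidAlgebra S G ⧸ M) = 0 := by
    have := (hker p).mp hpS
    simpa using this
  have : Fact p.Prime := ⟨hp⟩
  have : CharP (MonoidAlgebra S G ⧸ M) p :=
    (CharP.charP_iff_prime_eq_zero hp).mpr hp0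
  have hNF : (N : MonoidAlgebra S G ⧸ M) ≠ 0 := fun h => hpN ((CharP.cast_eq_zero_iff _ p N).mp h)
  have hζF := isPrimitiveRoot_map_of_natCast_ne_zero f hζ hNF
  -- reduction identifies the `N`-th roots of unity of `S` with those of the quotient field
  have hbij : Function.Bijective (restrictRootsOfUnity f N) := by
    have hsurj : Function.Surjective (restrictRootsOfUnity f N) := by
      intro u
      obtain ⟨i, -, hi⟩ := hζF.eq_pow_of_pow_eq_one (ξ := (u.1.1 : MonoidAlgebra S G ⧸ M))
        (by simpa using congrArg Units.val ((mem_rootsOfUnity N u.1).mp u.2))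
      refine ⟨rootsOfUnity.mkOfPowEq (ζ ^ i) ?_, ?_⟩
      · rw [← pow_mul, mul_comm, pow_mul, hζ.pow_eq_one, one_pow]
      · apply Subtype.ext
        apply Units.ext
        rw [restrictRootsOfUnity_coe_apply, rootsOfUnity.val_mkOfPowEq_coe, map_pow, hi]
    exact (Nat.bijective_iff_surjective_and_card _).mpr
      ⟨hsurj, by rw [hζ.card_rootsOfUnity, hζF.card_rootsOfUnity]⟩
  let e := MulEquiv.ofBijective (restrictRootsOfUnity f N) hbij
  -- the `p`-part of `G` dies in the quotient field, which has characteristic `p`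
  have hθ : ∀ g : G, (π (MonoidAlgebra.single g 1)) ^ N = 1 := by
    intro g
    have h1 : ((π (MonoidAlgebra.single g 1)) ^ N) ^ p ^ a = 1 := by
      rw [← pow_mul, mul_comm, ← hexp, ← map_pow, MonoidAlgebra.single_pow,
        Monoid.pow_exponent_eq_one, one_pow, ← MonoidAlgebra.one_def, map_one]
    apply iterateFrobenius_inj (MonoidAlgebra S G ⧸ M) p a
    simpa [iterateFrobenius_def] using h1
  let θ : G →* rootsOfUnity N (MonoidAlgebra S G ⧸ M) :=
    { toFun := fun g => rootsOfUnity.mkOfPowEq _ (hθ g)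
      map_one' := by
        apply Subtype.ext; apply Units.ext
        rw [rootsOfUnity.val_mkOfPowEq_coe, ← MonoidAlgebra.one_def, map_one]; rfl
      map_mul' := fun g h => by
        apply Subtype.ext; apply Units.ext
        simp only [rootsOfUnity.val_mkOfPowEq_coe, Subgroup.coe_mul, Units.val_mul, ← map_mul,
          MonoidAlgebra.single_mul_single, mul_one] }
  refine ⟨e.symm.toMonoidHom.comp θ, ?_⟩
  rw [hker]
  have hcomp : f.comp (charEval (e.symm.toMonoidHom.comp θ)).toRingHom = π := by
    apply MonoidAlgebra.ringHom_ext
    · intro s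
      simp [charEval_single, f]
    · intro g
      have h2 : restrictRootsOfUnity f N (e.symm (θ g)) = θ g := e.apply_symm_apply (θ g)
      have h3 := congrArg (fun u : rootsOfUnity N (MonoidAlgebra S G ⧸ M) => u.1.1) h2
      simp only [restrictRootsOfUnity_coe_apply] at h3
      simp only [RingHom.comp_apply, AlgHom.toRingHom_eq_coe, RingHom.coe_coe, charEval_single,
        one_mul]
      refine h3.trans ?_
      exact rootsOfUnity.val_mkOfPowEq_coe _ (hθ g)
  have h4 := congrArg (fun k => k x) hcomp
  exact h4.trans (Ideal.Quotient.eq_zero_iff_mem.mpr hx)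

theorem isUnit_of_forall_isUnit_charEval [IsDomain S] [IsLocalRing S] [Finite G] {p a : ℕ}
    (hp : p.Prime) (hpN : ¬ p ∣ N) (hexp : Monoid.exponent G = p ^ a * N)
    (hpS : (p : S) ∈ IsLocalRing.maximalIdeal S) {ζ : S} (hζ : IsPrimitiveRoot ζ N)
    {x : MonoidAlgebra S G} (hx : ∀ χ : G →* rootsOfUnity N S, IsUnit (charEval χ x)) :
    IsUnit x := by
  by_contra h
  obtain ⟨M, hM, hxM⟩ := exists_max_ideal_of_mem_nonunits h
  obtain ⟨χ, hχ⟩ := exists_charEval_mem_of_mem_maximal hp hpN hexp hpS hζ M hxM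
  exact hχ (hx χ)

/-- The element `|H|⁻¹ ∑_{h ∈ H} χ(h⁻¹) h` of `S[G]`, where `c` stands for `|H|⁻¹`. The
subgroup `H` is meant to be the prime-to-`p` part of `G`, whose order is invertible in `S`. -/
noncomputable def charIdem (H : Subgroup G) [Fintype H] (c : S) (χ : G →* rootsOfUnity N S) :
    MonoidAlgebra S G :=
  ∑ h : H, MonoidAlgebra.single (h : G) (c * ((χ (h : G)⁻¹ : Sˣ) : S))

theorem charEval_charIdem [IsDomain S] (H : Subgroup G) [Fintype H] {c : S}
    (hc : c * (Fintype.card H : S) = 1)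
    (hH : ∀ χ ψ : G →* rootsOfUnity N S, (∀ h ∈ H, χ h = ψ h) → χ = ψ)
    (χ ψ : G →* rootsOfUnity N S) [Decidable (ψ = χ)] :
    charEval ψ (charIdem H c χ) = if ψ = χ then 1 else 0 := by
  classical
  let φ : H →* S := (Units.coeHom S).comp ((rootsOfUnity N S).subtype.comp
    ((ψ * χ⁻¹).comp H.subtype))
  have h1 : charEval ψ (charIdem H c χ) = c * ∑ h : H, φ h := by
    rw [charIdem, map_sum, Finset.mul_sum]
    refine Finset.sum_congr rfl fun h _ => ?_
    rw [charEval_single]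
    simp only [φ, MonoidHom.comp_apply, MonoidHom.mul_apply, MonoidHom.inv_apply, map_mul,
      map_inv, Subgroup.coe_subtype, Subgroup.coe_inv, Units.coeHom_apply]
    ring
  have h2 : φ = 1 ↔ ψ = χ := by
    constructor
    · intro h
      refine hH _ _ fun g hg => ?_
      have h3 := DFunLike.congr_fun h ⟨g, hg⟩
      have h4 : ψ g * (χ g)⁻¹ = 1 := by
        apply Subtype.ext; apply Units.ext
        exact h3
      exact mul_inv_eq_one.mp h4
    · rintro rfl
      ext h
      simp [φ]
  rw [h1, sum_hom_units]
  simp only [h2]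
  split_ifs
  · exact hc
  · rw [Nat.cast_zero, mul_zero]

theorem single_mul_charIdem (H : Subgroup G) [Fintype H] (c : S) (χ : G →* rootsOfUnity N S)
    (h : H) : MonoidAlgebra.single (h : G) 1 * charIdem H c χ =
      ((χ (h : G) : Sˣ) : S) • charIdem H c χ := by
  rw [charIdem, Finset.mul_sum, Finset.smul_sum]
  rw [← Equiv.sum_comp (Equiv.mulLeft h) (fun k : H => ((χ (h : G) : Sˣ) : S) •
    MonoidAlgebra.single (k : G) (c * ((χ (k : G)⁻¹ : Sˣ) : S)))]
  refine Finset.sum_congr rfl fun k _ => ?_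
  rw [MonoidAlgebra.single_mul_single, MonoidAlgebra.smul_single]
  congr 1
  have h1 : (((χ (h : G))⁻¹ : Sˣ) : S) * ((χ (h : G) : Sˣ) : S) = 1 := Units.inv_mul _
  simp only [Equiv.coe_mulLeft, Subgroup.coe_mul, mul_inv_rev, map_mul, map_inv, Units.val_mul,
    smul_eq_mul, InvMemClass.coe_inv, one_mul]
  linear_combination (-c * (((χ (k : G))⁻¹ : Sˣ) : S)) * h1

theorem charIdem_mul (H : Subgroup G) [Fintype H] (c : S) (χ ψ : G →* rootsOfUnity N S) :
    charIdem H c χ * charIdem H c ψ = charEval ψ (charIdem H c χ) • charIdem H c ψ := by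
  conv_lhs => rw [charIdem, Finset.sum_mul]
  conv_rhs => rw [charIdem, map_sum, Finset.sum_smul]
  refine Finset.sum_congr rfl fun h _ => ?_
  rw [charEval_single, mul_smul, ← single_mul_charIdem, ← smul_mul_assoc,
    MonoidAlgebra.smul_single, smul_eq_mul, mul_one]

theorem orthogonalIdempotents_charIdem [IsDomain S] (H : Subgroup G) [Fintype H] {c : S}
    (hc : c * (Fintype.card H : S) = 1)
    (hH : ∀ χ ψ : G →* rootsOfUnity N S, (∀ h ∈ H, χ h = ψ h) → χ = ψ) :
    OrthogonalIdempotents (charIdem (N := N) H c) := by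
  classical
  refine OrthogonalIdempotents.iff_mul_eq.mpr fun χ ψ => ?_
  rw [charIdem_mul, charEval_charIdem H hc hH]
  by_cases h : χ = ψ
  · simp [h]
  · rw [if_neg (Ne.symm h), if_neg h, zero_smul]

end Characters

/-! ### Galois descent of idempotents and inverses -/

section Descent

variable {R S G : Type*} [CommRing R] [CommRing S] [Algebra R S] [CommGroup G] {N : ℕ}

/-- The action of an automorphism of `S` on the characters with values in the roots of unity. -/
def charTwist (σ : S ≃ₐ[R] S) (χ : G →* rootsOfUnity N S) : G →* rootsOfUnity N S :=
  (restrictRootsOfUnity σ N).comp χ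

theorem charTwist_symm_charTwist (σ : S ≃ₐ[R] S) (χ : G →* rootsOfUnity N S) :
    charTwist σ.symm (charTwist σ χ) = χ := by
  ext g
  simp [charTwist]

theorem charTwist_charTwist_symm (σ : S ≃ₐ[R] S) (χ : G →* rootsOfUnity N S) :
    charTwist σ (charTwist σ.symm χ) = χ := by
  ext g
  simp [charTwist]

theorem charEval_charTwist (σ : S ≃ₐ[R] S) (χ : G →* rootsOfUnity N S)
    (x : MonoidAlgebra S G) :
    charEval (charTwist σ χ) (MonoidAlgebra.mapRingHom G (σ : S →+* S) x) = σ (charEval χ x) := by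
  have h : (charEval (charTwist σ χ)).toRingHom.comp (MonoidAlgebra.mapRingHom G (σ : S →+* S)) =
      (σ : S →+* S).comp (charEval χ).toRingHom := by
    apply MonoidAlgebra.ringHom_ext
    · intro s
      simp [charEval_single]
    · intro g
      simp [charEval_single, charTwist]
  exact congrArg (fun k => k x) h

theorem map_charIdem (σ : S ≃ₐ[R] S) (H : Subgroup G) [Fintype H] (c : S)
    (χ : G →* rootsOfUnity N S) :
    MonoidAlgebra.mapRingHom G (σ : S →+* S) (charIdem H c χ) =
      charIdem H (σ c) (charTwist σ χ) := by
  rw [charIdem, charIdem, map_sum]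
  refine Finset.sum_congr rfl fun h _ => ?_
  rw [MonoidAlgebra.mapRingHom_single]
  congr 1
  rw [RingHom.coe_coe, map_mul]
  rfl

/-- Elements of `S[G]` fixed by all `R`-automorphisms of `S` come from `R[G]`. -/
theorem exists_mapRingHom_eq_of_forall_algEquiv
    (hinv : ∀ s : S, (∀ σ : S ≃ₐ[R] S, σ s = s) → ∃ r, algebraMap R S r = s)
    {y : MonoidAlgebra S G}
    (hy : ∀ σ : S ≃ₐ[R] S, MonoidAlgebra.mapRingHom G (σ : S →+* S) y = y) :
    ∃ x : MonoidAlgebra R G, MonoidAlgebra.mapRingHom G (algebraMap R S) x = y := by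
  have h : ∀ g, ∃ r, algebraMap R S r = y.coeff g := by
    intro g
    refine hinv _ fun σ => ?_
    have := congrArg (fun z => z.coeff g) (hy σ)
    simpa using this
  choose r hr using h
  refine ⟨∑ g ∈ y.coeff.support, MonoidAlgebra.single g (r g), ?_⟩
  simp only [map_sum, MonoidAlgebra.mapRingHom_single, hr]
  exact y.sum_coeff_single

theorem mapRingHom_algebraMap_injective (hinj : Function.Injective (algebraMap R S)) :
    Function.Injective (MonoidAlgebra.mapRingHom G (algebraMap R S)) := by
  intro x y h
  ext g
  apply hinj
  rw [← MonoidAlgebra.coeff_mapRingHom, h, MonoidAlgebra.coeff_mapRingHom]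

/-- Let `S` be a local domain over `R` whose `R`-automorphisms fix nothing but `R`, and which
contains the roots of unity of order the prime-to-`p` part `N` of the exponent of `G`. Given `x` in `R[G]`,
the characters `χ` with `χ(x)` in the maximal ideal of `S` form a set stable under automorphisms,
hence the sum `e` of their idempotents lies in `R[G]`. Every character takes a unit value at
`x - e`, so `x - e` is a unit of `S[G]`, and its inverse lies in `R[G]` by descent again. -/
theorem isCleanRing_monoidAlgebra_of_isLocalRing [IsDomain S] [IsLocalRing S] [Finite G]
    (hinj : Function.Injective (algebraMap R S))
    (hinv : ∀ s : S, (∀ σ : S ≃ₐ[R] S, σ s = s) → ∃ r, algebraMap R S r = s)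
    {p a : ℕ} (hp : p.Prime) (hpN : ¬ p ∣ N) (hexp : Monoid.exponent G = p ^ a * N)
    (hpS : (p : S) ∈ IsLocalRing.maximalIdeal S) {ζ : S} (hζ : IsPrimitiveRoot ζ N) :
    IsCleanRing (MonoidAlgebra R G) := by
  classical
  have hN0 : N ≠ 0 := fun h => hpN (h ▸ dvd_zero p)
  have : NeZero N := ⟨hN0⟩
  have : Finite (G →* rootsOfUnity N S) := Finite.of_injective _ DFunLike.coe_injective
  let _ := Fintype.ofFinite (G →* rootsOfUnity N S)
  -- the subgroup of elements of order prime to `p`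
  let H : Subgroup G := (powMonoidHom (p ^ a) : G →* G).range
  let _ := Fintype.ofFinite H
  have hH : ∀ χ ψ : G →* rootsOfUnity N S, (∀ h ∈ H, χ h = ψ h) → χ = ψ := by
    intro χ ψ h
    ext1 g
    have h1 : (χ g) ^ p ^ a = (ψ g) ^ p ^ a := by
      rw [← map_pow, ← map_pow]
      exact h _ ⟨g, rfl⟩
    have hcard : Nat.card (rootsOfUnity N S) = N := hζ.card_rootsOfUnity
    -- raising to the power `p ^ a` is injective on `N`-th roots of unity
    exact (powCoprime (G := rootsOfUnity N S) (n := p ^ a) (by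
      rw [hcard]; exact ((hp.coprime_iff_not_dvd.mpr hpN).pow_left a).symm)).injective h1
  have hcop : Nat.Coprime p (Fintype.card H) := by
    rw [hp.coprime_iff_not_dvd]
    intro hdvd
    have : Fact p.Prime := ⟨hp⟩
    obtain ⟨⟨h, g, rfl⟩, hh⟩ := exists_prime_orderOf_dvd_card p hdvd
    apply hpN
    rw [← hh, orderOf_dvd_iff_pow_eq_one]
    apply Subtype.ext
    change (g ^ p ^ a) ^ N = 1
    rw [← pow_mul, ← hexp, Monoid.pow_exponent_eq_one]
  obtain ⟨c, hc⟩ : ∃ c : S, c * (Fintype.card H : S) = 1 := by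
    have h1 : IsUnit (Fintype.card H : S) := by
      by_contra hnu
      have h2 := (IsLocalRing.mem_maximalIdeal _).mpr hnu
      apply (IsLocalRing.maximalIdeal.isMaximal S).ne_top
      rw [Ideal.eq_top_iff_one]
      have h3 := hcop.isCoprime.map (Int.castRingHom S)
      obtain ⟨u, v, huv⟩ := h3
      rw [← huv]
      exact add_mem (Ideal.mul_mem_left _ _ (by simpa using hpS))
        (Ideal.mul_mem_left _ _ (by simpa using h2))
    obtain ⟨c, hc⟩ := h1.exists_left_inv
    exact ⟨c, hc⟩
  have hσc : ∀ σ : S ≃ₐ[R] S, σ c = c := by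
    intro σ
    have h1 := congrArg σ hc
    rw [map_mul, map_natCast, map_one] at h1
    linear_combination c * h1 - σ c * hc
  intro x
  let ι := MonoidAlgebra.mapRingHom G (algebraMap R S)
  have hσι : ∀ (σ : S ≃ₐ[R] S) (z : MonoidAlgebra R G),
      MonoidAlgebra.mapRingHom G (σ : S →+* S) (ι z) = ι z := by
    intro σ z
    ext g
    simp [ι]
  let T : Finset (G →* rootsOfUnity N S) :=
    {χ | charEval χ (ι x) ∈ IsLocalRing.maximalIdeal S}
  have hT : ∀ χ, χ ∈ T ↔ charEval χ (ι x) ∈ IsLocalRing.maximalIdeal S := fun χ => by simp [T]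
  have hTσ : ∀ (σ : S ≃ₐ[R] S) (χ), χ ∈ T → charTwist σ χ ∈ T := by
    intro σ χ hχ
    rw [hT] at hχ ⊢
    rw [← hσι σ x, charEval_charTwist]
    rw [IsLocalRing.mem_maximalIdeal, mem_nonunits_iff] at hχ ⊢
    rwa [MulEquiv.isUnit_map]
  let e : MonoidAlgebra S G := ∑ χ ∈ T, charIdem H c χ
  have he : IsIdempotentElem e :=
    (orthogonalIdempotents_charIdem H hc hH).isIdempotentElem_sum
  have heσ : ∀ σ : S ≃ₐ[R] S, MonoidAlgebra.mapRingHom G (σ : S →+* S) e = e := by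
    intro σ
    rw [map_sum]
    refine Finset.sum_nbij' (charTwist σ) (charTwist σ.symm) (hTσ σ) (hTσ σ.symm)
      (fun χ _ => charTwist_symm_charTwist σ χ) (fun χ _ => charTwist_charTwist_symm σ χ)
      (fun χ _ => ?_)
    rw [map_charIdem, hσc]
  obtain ⟨e₀, he₀⟩ := exists_mapRingHom_eq_of_forall_algEquiv hinv heσ
  have hιinj := mapRingHom_algebraMap_injective (G := G) hinj
  have hev : ∀ ψ : G →* rootsOfUnity N S, charEval ψ e = if ψ ∈ T then 1 else 0 := by
    intro ψ
    rw [map_sum, Finset.sum_congr rfl fun χ _ => charEval_charIdem H hc hH χ ψ]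
    simp
  have hunit : IsUnit (ι x - e) := by
    refine isUnit_of_forall_isUnit_charEval hp hpN hexp hpS hζ fun ψ => ?_
    rw [map_sub, hev]
    by_cases hψ : ψ ∈ T
    · rw [if_pos hψ]
      by_contra hnu
      apply (IsLocalRing.maximalIdeal.isMaximal S).ne_top
      rw [Ideal.eq_top_iff_one]
      rw [← sub_sub_cancel (charEval ψ (ι x)) 1]
      exact sub_mem ((hT ψ).mp hψ) ((IsLocalRing.mem_maximalIdeal _).mpr hnu)
    · rw [if_neg hψ, sub_zero]
      by_contra hnu
      exact hψ ((hT ψ).mpr hnu)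
  obtain ⟨y, hy⟩ := hunit.exists_right_inv
  have hyσ : ∀ σ : S ≃ₐ[R] S, MonoidAlgebra.mapRingHom G (σ : S →+* S) y = y := by
    intro σ
    have h1 := congrArg (MonoidAlgebra.mapRingHom G (σ : S →+* S)) hy
    rw [map_mul, map_sub, hσι, heσ, map_one] at h1
    exact hunit.mul_left_cancel (h1.trans hy.symm)
  obtain ⟨y₀, hy₀⟩ := exists_mapRingHom_eq_of_forall_algEquiv hinv hyσ
  refine ⟨x - e₀, e₀, IsUnit.of_mul_eq_one y₀ (hιinj ?_), hιinj ?_, by ring⟩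
  · rw [map_mul, map_sub, he₀, hy₀, map_one]
    exact hy
  · rw [map_mul, he₀]
    exact he

end Descent

/-! ### Local cyclotomic orders -/

section Adjoin

open Polynomial

variable {R : Type*} [CommRing R] {E : Type*} [Field E] [Algebra R E] {N : ℕ}

/-- A finite abelian group whose exponent is a multiple of `N` has a character with values in the
`N`-th roots of unity that attains a given primitive one: the subgroup of `d`-th powers has exponent
`N`, and is isomorphic to its dual. -/
theorem exists_monoidHom_apply_eq {G : Type*} [CommGroup G] [Finite G] {d : ℕ}
    (hd : Monoid.exponent G = d * N) (hN : N ≠ 0) {ζ : E} (hζ : IsPrimitiveRoot ζ N) :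
    ∃ (χ : G →* Eˣ), (∃ g, (χ g : E) = ζ) ∧ ∀ g, (χ g : E) ^ N = 1 := by
  have : NeZero N := ⟨hN⟩
  have hd0 : d ≠ 0 := fun h => Monoid.exponent_ne_zero_of_finite (G := G) (by rw [hd, h, zero_mul])
  let H : Subgroup G := (powMonoidHom d : G →* G).range
  have hHexp : Monoid.exponent H = N := by
    apply Nat.dvd_antisymm
    · apply Monoid.exponent_dvd_of_forall_pow_eq_one
      rintro ⟨_, g, rfl⟩
      apply Subtype.ext
      change (g ^ d) ^ N = 1
      rw [← pow_mul, ← hd, Monoid.pow_exponent_eq_one]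
    · apply Nat.dvd_of_mul_dvd_mul_left (Nat.pos_of_ne_zero hd0)
      rw [← hd]
      apply Monoid.exponent_dvd_of_forall_pow_eq_one
      intro g
      rw [pow_mul]
      exact congrArg Subtype.val (Monoid.pow_exponent_eq_one (⟨g ^ d, g, rfl⟩ : H))
  have : HasEnoughRootsOfUnity E N := ⟨⟨ζ, hζ⟩, rootsOfUnity.isCyclic E N⟩
  have : HasEnoughRootsOfUnity E (Monoid.exponent H) := by rwa [hHexp]
  obtain ⟨m⟩ := CommGroup.monoidHom_mulEquiv_of_hasEnoughRootsOfUnity H E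
  obtain ⟨h, hh⟩ := Monoid.exists_orderOf_eq_exponent (Monoid.ExponentExists.of_finite (G := H))
  let χ := m.symm h
  have hχ : orderOf χ = N := by rw [MulEquiv.orderOf_eq, hh, hHexp]
  have hχN : ∀ k, χ k ^ N = 1 := fun k => by
    have h1 := pow_orderOf_eq_one χ
    rw [hχ] at h1
    exact DFunLike.congr_fun h1 k
  have : Finite χ.range := Finite.of_surjective _ χ.rangeRestrict_surjective
  obtain ⟨⟨_, k, rfl⟩, hu⟩ := IsCyclic.exists_generator (α := χ.range)
  have hprim : IsPrimitiveRoot (χ k) N := by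
    refine IsPrimitiveRoot.mk_of_lt _ (Nat.pos_of_ne_zero hN) (hχN k) fun l hl0 hlN hl => ?_
    have h1 : χ ^ l = 1 := by
      ext1 j
      obtain ⟨i, hi⟩ := hu ⟨χ j, j, rfl⟩
      have h2 : χ k ^ i = χ j := congrArg Subtype.val hi
      rw [MonoidHom.pow_apply, ← h2, ← zpow_natCast, ← zpow_mul, mul_comm, zpow_mul, zpow_natCast,
        hl, one_zpow]
      rfl
    have h3 := Nat.le_of_dvd hl0 (orderOf_dvd_of_pow_eq_one h1)
    rw [hχ] at h3
    omega
  obtain ⟨i, -, hi⟩ := (IsPrimitiveRoot.coe_units_iff.mpr hprim).eq_pow_of_pow_eq_one hζ.pow_eq_one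
  obtain ⟨_, g, rfl⟩ := k
  refine ⟨χ.comp (powMonoidHom d : G →* G).rangeRestrict, ⟨g ^ i, ?_⟩, fun g => ?_⟩
  · rw [map_pow, Units.val_pow_eq_pow_val]
    exact hi
  · simpa using congrArg Units.val (hχN _)

/-- The ring `R[ζ]` is a quotient of `R[G]` through a character of `G`. -/
theorem IsCleanRing.adjoin_of_monoidAlgebra {G : Type*} [CommGroup G] [Finite G]
    (hR : IsCleanRing (MonoidAlgebra R G)) {d : ℕ} (hd : Monoid.exponent G = d * N) (hN : N ≠ 0)
    {ζ : E} (hζ : IsPrimitiveRoot ζ N) : IsCleanRing (Algebra.adjoin R {ζ}) := by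
  have : NeZero N := ⟨hN⟩
  obtain ⟨χ, ⟨g, hg⟩, hχ⟩ := exists_monoidHom_apply_eq hd hN hζ
  let f : MonoidAlgebra R G →ₐ[R] E := MonoidAlgebra.lift R E G ((Units.coeHom E).comp χ)
  have hf : f.range = Algebra.adjoin R {ζ} := by
    apply le_antisymm
    · rintro _ ⟨x, rfl⟩
      induction x using MonoidAlgebra.induction_linear with
      | zero => exact (map_zero f).symm ▸ zero_mem _
      | add x y hx hy => exact (map_add f x y).symm ▸ add_mem hx hy
      | single h r =>
        obtain ⟨i, -, hi⟩ := hζ.eq_pow_of_pow_eq_one (hχ h)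
        have : f (MonoidAlgebra.single h r) = r • ζ ^ i := by
          rw [hi]
          exact MonoidAlgebra.lift_single _ _ _
        exact this.symm ▸ Subalgebra.smul_mem _
          (pow_mem (Algebra.subset_adjoin (Set.mem_singleton ζ)) i) r
    · rw [Algebra.adjoin_le_iff, Set.singleton_subset_iff]
      refine ⟨MonoidAlgebra.single g 1, ?_⟩
      refine (MonoidAlgebra.lift_single _ _ _).trans ?_
      rw [one_smul]
      exact hg
  rw [← hf]
  exact hR.of_surjective f.rangeRestrict.toRingHom f.rangeRestrict_surjective

variable [IsDomain R] [IsIntegrallyClosed R] [IsLocalRing R] [Module.IsTorsionFree R E]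

/-- In `R[ζ] ≃ R[X] / (f)`, where `f` is the minimal polynomial of `ζ`, the maximal ideal of `R`
lies in the Jacobson radical, so units are detected in `k[X] / (f mod 𝔪)`, `k` being the residue
field. -/
theorem isUnit_aeval_adjoin_iff {ζ : E} (hζ : IsIntegral R ζ) (P : R[X]) :
    IsUnit (aeval (⟨ζ, Algebra.self_mem_adjoin_singleton R ζ⟩ : Algebra.adjoin R {ζ}) P) ↔
      IsCoprime (P.map (IsLocalRing.residue R)) ((minpoly R ζ).map (IsLocalRing.residue R)) := by
  set z : Algebra.adjoin R {ζ} := ⟨ζ, Algebra.self_mem_adjoin_singleton R ζ⟩ with hz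
  have hcoe : ∀ Q : R[X], ((aeval z Q : Algebra.adjoin R {ζ}) : E) = aeval ζ Q := fun Q => by
    rw [← Subalgebra.coe_val, ← aeval_algHom_apply]
    rfl
  have hsurj : ∀ y : Algebra.adjoin R {ζ}, ∃ Q : R[X], aeval z Q = y := by
    rintro ⟨y, hy⟩
    rw [Algebra.adjoin_singleton_eq_range_aeval] at hy
    obtain ⟨Q, rfl⟩ := hy
    exact ⟨Q, Subtype.ext (hcoe Q)⟩
  have hmapsurj := Polynomial.map_surjective _ (IsLocalRing.residue_surjective (R := R))
  constructor
  · intro h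
    obtain ⟨y, hy⟩ := h.exists_left_inv
    obtain ⟨Q, rfl⟩ := hsurj y
    have h1 : aeval ζ (Q * P - 1) = 0 := by
      rw [← hcoe, map_sub, map_mul, hy]
      simp
    obtain ⟨A, hA⟩ := minpoly.isIntegrallyClosed_dvd hζ h1
    refine ⟨Q.map (IsLocalRing.residue R), - A.map (IsLocalRing.residue R), ?_⟩
    have h2 := congrArg (Polynomial.map (IsLocalRing.residue R)) hA
    simp only [Polynomial.map_sub, Polynomial.map_mul, Polynomial.map_one] at h2
    linear_combination h2
  · rintro ⟨u, v, huv⟩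
    obtain ⟨U, rfl⟩ := hmapsurj u
    obtain ⟨V, rfl⟩ := hmapsurj v
    by_contra hnu
    obtain ⟨M, hM, hPM⟩ := exists_max_ideal_of_mem_nonunits hnu
    have : Algebra.IsIntegral R (Algebra.adjoin R {ζ}) :=
      Algebra.IsIntegral.adjoin (by simpa using hζ)
    have hmax : (M.comap (algebraMap R (Algebra.adjoin R {ζ}))).IsMaximal :=
      Ideal.isMaximal_comap_of_isIntegral_of_isMaximal M
    have hcomap := IsLocalRing.eq_maximalIdeal hmax
    have hf : aeval z (minpoly R ζ) = 0 := Subtype.ext (by rw [hcoe, minpoly.aeval]; rfl)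
    have h0 : ∀ Q : R[X], Q.map (IsLocalRing.residue R) = 0 → aeval z Q ∈ M := by
      intro Q hQ
      rw [aeval_eq_sum_range]
      refine sum_mem fun i _ => ?_
      rw [Algebra.smul_def]
      refine Ideal.mul_mem_right _ _ ?_
      rw [← Ideal.mem_comap, hcomap, ← IsLocalRing.residue_eq_zero_iff, ← coeff_map, hQ, coeff_zero]
    apply hM.ne_top
    rw [Ideal.eq_top_iff_one]
    have h1 := h0 (U * P + V * minpoly R ζ - 1) (by
      simp only [Polynomial.map_sub, Polynomial.map_add, Polynomial.map_mul, Polynomial.map_one,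
        huv, sub_self])
    rw [map_sub, map_add, map_mul, map_mul, hf, mul_zero, add_zero, map_one] at h1
    rw [← sub_sub_cancel (aeval z U * aeval z P) 1]
    exact sub_mem (Ideal.mul_mem_left _ _ hPM) h1

/-- If the reduction of the minimal polynomial factored as a product of coprime nonunits `g` and `h`
with `u g + v h = 1`, a lift of `u g` would be an element `a` of `R[ζ]` such that neither `a` nor
`1 - a` is a unit. -/
theorem isLocalRing_adjoin_iff_irreducible {ζ : E} (hζ : IsIntegral R ζ)
    (hsep : ((minpoly R ζ).map (IsLocalRing.residue R)).Separable) :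
    IsLocalRing (Algebra.adjoin R {ζ}) ↔
      Irreducible ((minpoly R ζ).map (IsLocalRing.residue R)) := by
  set fbar := (minpoly R ζ).map (IsLocalRing.residue R) with hfbar
  set z : Algebra.adjoin R {ζ} := ⟨ζ, Algebra.self_mem_adjoin_singleton R ζ⟩ with hz
  have hmapsurj := Polynomial.map_surjective _ (IsLocalRing.residue_surjective (R := R))
  have hsurj : ∀ y : Algebra.adjoin R {ζ}, ∃ Q : R[X], aeval z Q = y := by
    rintro ⟨y, hy⟩
    rw [Algebra.adjoin_singleton_eq_range_aeval] at hy
    obtain ⟨Q, rfl⟩ := hy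
    refine ⟨Q, Subtype.ext ?_⟩
    rw [← Subalgebra.coe_val, ← aeval_algHom_apply]
    rfl
  constructor
  · intro hloc
    refine ⟨fun hu => ?_, fun g h hgh => ?_⟩
    · have h1 := (isUnit_aeval_adjoin_iff hζ (0 : R[X])).mpr (by
        obtain ⟨b, hb⟩ := hu.exists_left_inv
        exact ⟨0, b, by rw [zero_mul, zero_add, hb]⟩)
      rw [map_zero] at h1
      exact not_isUnit_zero h1
    · have hco : IsCoprime g h := by
        rw [hgh] at hsep
        exact hsep.isCoprime
      obtain ⟨u, v, huv⟩ := hco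
      obtain ⟨A, hA⟩ := hmapsurj (u * g)
      rcases IsLocalRing.isUnit_or_isUnit_one_sub_self (aeval z A) with h1 | h1
      · rw [isUnit_aeval_adjoin_iff hζ, hA, ← hfbar, hgh] at h1
        exact Or.inl (h1.of_mul_left_right.of_mul_right_left.isUnit_of_dvd' dvd_rfl dvd_rfl)
      · have h2 : 1 - aeval z A = aeval z (1 - A) := by rw [map_sub, map_one]
        have h3 : (1 - A).map (IsLocalRing.residue R) = v * h := by
          rw [Polynomial.map_sub, Polynomial.map_one, hA, ← huv]
          ring
        rw [h2, isUnit_aeval_adjoin_iff hζ, h3, ← hfbar, hgh] at h1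
        exact Or.inr (h1.of_mul_left_right.of_mul_right_right.isUnit_of_dvd' dvd_rfl dvd_rfl)
  · intro hirr
    refine IsLocalRing.of_isUnit_or_isUnit_one_sub_self fun y => ?_
    obtain ⟨P, rfl⟩ := hsurj y
    have h2 : 1 - aeval z P = aeval z (1 - P) := by rw [map_sub, map_one]
    rw [h2, isUnit_aeval_adjoin_iff hζ, isUnit_aeval_adjoin_iff hζ, ← hfbar]
    by_cases hd : fbar ∣ P.map (IsLocalRing.residue R)
    · right
      rw [Polynomial.map_sub, Polynomial.map_one]
      obtain ⟨c, hc⟩ := hd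
      exact ⟨1, c, by rw [hc]; ring⟩
    · left
      exact ((hirr.coprime_iff_not_dvd).mpr hd).symm

variable (K : Type*) [Field K] [Algebra R K] [IsFractionRing R K] [Algebra K E]
  [IsScalarTower R K E]

/-- The ring `R[ζ_N]` is local exactly when the minimal polynomial of `ζ_N` stays irreducible over
the residue field, where the irreducible factors of the `N`-th cyclotomic polynomial all have degree
the order of `p ^ f` modulo `N`. -/
theorem isLocalRing_adjoin_iff_natDegree {p f : ℕ} (hp : p.Prime)
    (hcard : Nat.card (IsLocalRing.ResidueField R) = p ^ f) (hpN : ¬ p ∣ N)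
    {ζ : E} (hζ : IsPrimitiveRoot ζ N) :
    IsLocalRing (Algebra.adjoin R {ζ}) ↔
      (minpoly K ζ).natDegree = orderOf ((p ^ f : ℕ) : ZMod N) := by
  have hN0 : N ≠ 0 := fun h => hpN (h ▸ dvd_zero p)
  have : Fact p.Prime := ⟨hp⟩
  have : Finite (IsLocalRing.ResidueField R) :=
    Nat.finite_of_card_ne_zero (by rw [hcard]; exact pow_ne_zero _ hp.ne_zero)
  let _ := Fintype.ofFinite (IsLocalRing.ResidueField R)
  rw [Nat.card_eq_fintype_card] at hcard
  have hchar : CharP (IsLocalRing.ResidueField R) p := charP_of_card_eq_prime_pow hcard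
  have hNk : (N : IsLocalRing.ResidueField R) ≠ 0 := fun h =>
    hpN ((CharP.cast_eq_zero_iff _ p N).mp h)
  have hcop : p.Coprime N := hp.coprime_iff_not_dvd.mpr hpN
  have hint : IsIntegral R ζ := (hζ.isIntegral (Nat.pos_of_ne_zero hN0)).tower_top
  have hNR : (N : R) ≠ 0 := fun h => hNk (by
    simpa using congrArg (IsLocalRing.residue R) h)
  have hNE : NeZero (N : E) := ⟨fun h => hNR (by
    apply FaithfulSMul.algebraMap_injective R E
    simpa using h)⟩
  have hdvd : (minpoly R ζ).map (IsLocalRing.residue R) ∣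
      cyclotomic N (IsLocalRing.ResidueField R) := by
    rw [← map_cyclotomic N (IsLocalRing.residue R)]
    apply Polynomial.map_dvd
    apply minpoly.isIntegrallyClosed_dvd hint
    have := isRoot_cyclotomic_iff.mpr hζ
    rw [aeval_def, eval₂_eq_eval_map, map_cyclotomic]
    exact this
  have hNk' : NeZero (N : IsLocalRing.ResidueField R) := ⟨hNk⟩
  have hsep : ((minpoly R ζ).map (IsLocalRing.residue R)).Separable :=
    (separable_cyclotomic N _).of_dvd hdvd
  have hdeg : ((minpoly R ζ).map (IsLocalRing.residue R)).natDegree =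
      (minpoly K ζ).natDegree := by
    rw [(minpoly.monic hint).natDegree_map,
      minpoly.isIntegrallyClosed_eq_field_fractions' K hint, (minpoly.monic hint).natDegree_map]
  have hord : orderOf ((p ^ f : ℕ) : ZMod N) =
      orderOf (ZMod.unitOfCoprime _ (hcop.pow_left f)) := by
    rw [← orderOf_units, ZMod.coe_unitOfCoprime]
  rw [isLocalRing_adjoin_iff_irreducible hint hsep, ← hdeg, hord]
  exact ⟨natDegree_of_dvd_cyclotomic_of_irreducible hcard hcop hdvd,
    irreducible_of_dvd_cyclotomic_of_natDegree hcard hcop hdvd⟩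

end Adjoin

/-! ### Multiplicative orders and totients -/

theorem ordMod_dvd_iff (m x k : ℕ) : ordMod m x ∣ k ↔ x ^ k ≡ 1 [MOD m] := by
  rw [ordMod, orderOf_dvd_iff_pow_eq_one, ← ZMod.natCast_eq_natCast_iff, Nat.cast_pow, Nat.cast_one]

theorem ordMod_dvd_totient {m x : ℕ} (h : Nat.Coprime x m) : ordMod m x ∣ Nat.totient m :=
  (ordMod_dvd_iff m x _).mpr (Nat.ModEq.pow_totient h)

theorem ordMod_pos {m x : ℕ} (hm : m ≠ 0) (h : Nat.Coprime x m) : 0 < ordMod m x :=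
  Nat.pos_of_dvd_of_pos (ordMod_dvd_totient h) (Nat.totient_pos.mpr (Nat.pos_of_ne_zero hm))

theorem ordMod_lcm (m₁ m₂ x : ℕ) :
    ordMod (Nat.lcm m₁ m₂) x = Nat.lcm (ordMod m₁ x) (ordMod m₂ x) := by
  have h : ∀ k, ordMod (Nat.lcm m₁ m₂) x ∣ k ↔ Nat.lcm (ordMod m₁ x) (ordMod m₂ x) ∣ k := by
    intro k
    rw [Nat.lcm_dvd_iff, ordMod_dvd_iff, ordMod_dvd_iff, ordMod_dvd_iff]
    simp only [Nat.modEq_iff_dvd, Int.natCast_dvd, Nat.lcm_dvd_iff]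
  exact Nat.dvd_antisymm ((h _).mpr dvd_rfl) ((h _).mp dvd_rfl)

/-- The order of `x ^ t` modulo `m₁`, where `t` is the order of `x` modulo `m₂`, is the relative
order of `x` modulo `lcm m₁ m₂` over its order modulo `m₂`. -/
theorem ordMod_pow_mul {m₁ m₂ x : ℕ} (hpos : 0 < ordMod m₂ x) :
    ordMod m₁ (x ^ ordMod m₂ x) * ordMod m₂ x = ordMod (Nat.lcm m₁ m₂) x := by
  have h2 : ordMod m₂ x ∣ ordMod (Nat.lcm m₁ m₂) x := by
    rw [ordMod_lcm]; exact Nat.dvd_lcm_right _ _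
  obtain ⟨s, hs⟩ := h2
  have h : ∀ k, ordMod m₁ (x ^ ordMod m₂ x) ∣ k ↔ s ∣ k := by
    intro k
    rw [ordMod_dvd_iff, ← pow_mul, ← ordMod_dvd_iff, ← Nat.mul_dvd_mul_iff_left hpos (b := s),
      ← hs, ordMod_lcm, Nat.lcm_dvd_iff]
    exact (and_iff_left (dvd_mul_right _ _)).symm
  rw [hs, mul_comm, Nat.dvd_antisymm ((h _).mpr dvd_rfl) ((h _).mp dvd_rfl)]

theorem totient_mul_of_forall_prime_dvd {n : ℕ} (m : ℕ) (h : ∀ q, q.Prime → q ∣ m → q ∣ n) :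
    Nat.totient (n * m) = m * Nat.totient n := by
  induction m using induction_on_primes with
  | zero => simp
  | one => simp
  | prime_mul q m hq ih =>
    rw [mul_left_comm, Nat.totient_mul_of_prime_of_dvd hq
      ((h q hq (dvd_mul_right _ _)).mul_right m),
      ih fun r hr hrm => h r hr (hrm.mul_left q), mul_assoc]

/-- If `y ≡ 1` modulo `n` and `q ∣ n`, then `y ^ q ≡ 1` modulo `q n`, since
`1 + y + ⋯ + y ^ (q - 1)` is congruent to `q` modulo `q`. -/
theorem ordMod_prime_mul_dvd {n q x : ℕ} (hqn : q ∣ n) : ordMod (q * n) x ∣ q * ordMod n x := by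
  rw [ordMod_dvd_iff, mul_comm q (ordMod n x), pow_mul]
  have h1 : x ^ ordMod n x ≡ 1 [MOD n] := (ordMod_dvd_iff _ _ _).mp dvd_rfl
  set y := x ^ ordMod n x
  rw [Nat.modEq_iff_dvd] at h1 ⊢
  rw [← dvd_neg, neg_sub] at h1 ⊢
  push_cast at h1 ⊢
  rw [← geom_sum_mul]
  refine mul_dvd_mul ?_ h1
  have h2 : (q : ℤ) ∣ y - 1 := (Int.natCast_dvd_natCast.mpr hqn).trans h1
  have h3 : ∑ i ∈ Finset.range q, (y : ℤ) ^ i ≡ ∑ i ∈ Finset.range q, (1 : ℤ) ^ i [ZMOD q] := by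
    apply Int.ModEq.sum
    intro i _
    exact Int.ModEq.pow i (Int.modEq_iff_dvd.mpr (by rwa [← dvd_neg, neg_sub]))
  have h4 := (Int.modEq_zero_iff_dvd (n := q) (a := ∑ i ∈ Finset.range q, (y : ℤ) ^ i)).mp
    (h3.trans (by simp))
  exact h4

theorem ordMod_mul_dvd {n x : ℕ} (m : ℕ) (h : ∀ q, q.Prime → q ∣ m → q ∣ n) :
    ordMod (n * m) x ∣ m * ordMod n x := by
  induction m using induction_on_primes with
  | zero => simp
  | one => simp
  | prime_mul q m hq ih =>
    rw [mul_left_comm, mul_assoc]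
    exact (ordMod_prime_mul_dvd ((h q hq (dvd_mul_right _ _)).mul_right m)).trans
      (mul_dvd_mul_left q (ih fun r hr hrm => h r hr (hrm.mul_left q)))

/-- Since `lcm A B ≤ A B ≤ A' B'`, equality at both ends forces equality throughout. -/
theorem mul_eq_lcm_iff {A A' B B' : ℕ} (hA : A ∣ A') (hB : B ∣ B') (hA' : 0 < A') (hB' : 0 < B') :
    A' * B' = Nat.lcm A B ↔ A = A' ∧ B = B' ∧ Nat.gcd A B = 1 := by
  have hA0 := Nat.pos_of_dvd_of_pos hA hA'
  have hB0 := Nat.pos_of_dvd_of_pos hB hB'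
  have hleA := Nat.le_of_dvd hA' hA
  have hleB := Nat.le_of_dvd hB' hB
  have hg : 0 < Nat.gcd A B := Nat.gcd_pos_of_pos_left _ hA0
  constructor
  · intro h
    have h1 : Nat.gcd A B * (A' * B') = A * B := by rw [h, Nat.gcd_mul_lcm]
    have h2 : A * B ≤ A' * B' := Nat.mul_le_mul hleA hleB
    have hpos : 0 < A' * B' := Nat.mul_pos hA' hB'
    have h3 : Nat.gcd A B = 1 := by nlinarith
    rw [h3, one_mul] at h1
    refine ⟨?_, ?_, h3⟩
    · by_contra hne
      have : A < A' := lt_of_le_of_ne hleA hne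
      nlinarith
    · by_contra hne
      have : B < B' := lt_of_le_of_ne hleB hne
      nlinarith
  · rintro ⟨rfl, rfl, h⟩
    exact (Nat.Coprime.lcm_eq_mul h).symm

theorem eq_of_pow_mul_eq_pow_mul {p a b x y : ℕ} (hp : p.Prime) (hx : ¬ p ∣ x) (hy : ¬ p ∣ y)
    (h : p ^ a * x = p ^ b * y) : x = y := by
  have hcx : ∀ c, Nat.Coprime x (p ^ c) := fun c =>
    ((hp.coprime_iff_not_dvd.mpr hx).pow_left c).symm
  have hcy : ∀ c, Nat.Coprime y (p ^ c) := fun c =>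
    ((hp.coprime_iff_not_dvd.mpr hy).pow_left c).symm
  exact Nat.dvd_antisymm ((hcx b).dvd_of_dvd_mul_left (h ▸ dvd_mul_left x _))
    ((hcy a).dvd_of_dvd_mul_left (h ▸ dvd_mul_left y _))

/-- The largest divisor of `n` prime to `p` is the cofactor of a power of `p`. -/
theorem exists_eq_pow_mul_of_isGreatest {p n d : ℕ} (hp : p.Prime) (hn : n ≠ 0)
    (hd : IsGreatest {d : ℕ | d ∣ n ∧ ¬ p ∣ d} d) : ∃ b, n = p ^ b * d := by
  obtain ⟨b, m, hm, rfl⟩ := Nat.exists_eq_pow_mul_and_not_dvd hn p hp.ne_one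
  refine ⟨b, ?_⟩
  have h1 : m ≤ d := hd.2 ⟨dvd_mul_left _ _, hm⟩
  have h2 : d ∣ m :=
    ((hp.coprime_iff_not_dvd.mpr hd.1.2).pow_left b).symm.dvd_of_dvd_mul_left hd.1.1
  have h3 : d ≤ m := Nat.le_of_dvd (Nat.pos_of_ne_zero fun h => hm (h ▸ dvd_zero p)) h2
  rw [le_antisymm h1 h3]

section

variable {p n e N a n₀ n₁ m' : ℕ} (hp : p.Prime) (hn : n ≠ 0) (he : e = p ^ a * N) (hN : ¬ p ∣ N)
    (h₀ : IsGreatest {d : ℕ | d ∣ n ∧ ¬ p ∣ d} n₀)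
    (h₁ : IsGreatest {d : ℕ | d ∣ e ∧ ¬ p ∣ d ∧ Nat.gcd d n₀ = 1} n₁)
    (h' : IsGreatest {d : ℕ | d ∣ Nat.lcm e n₀ / (n₀ * n₁) ∧ ¬ p ∣ d} m')

include hp he hN h₀ h₁ h'

/-- The prime-to-`p` part of `lcm e n₀` is `n₀ n₁ m'`. -/
theorem lcm_eq_mul_of_isGreatest : Nat.lcm N n₀ = n₁ * (n₀ * m') := by
  have hN0 : N ≠ 0 := fun h => hN (h ▸ dvd_zero p)
  have h00 : n₀ ≠ 0 := fun h => h₀.1.2 (h ▸ dvd_zero p)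
  have he0 : e ≠ 0 := he ▸ Nat.mul_ne_zero (pow_ne_zero _ hp.ne_zero) hN0
  have hdvd : n₀ * n₁ ∣ Nat.lcm e n₀ :=
    Nat.Coprime.mul_dvd_of_dvd_of_dvd (Nat.Coprime.symm h₁.1.2.2) (Nat.dvd_lcm_right _ _)
      (h₁.1.1.trans (Nat.dvd_lcm_left _ _))
  obtain ⟨Q, hQ⟩ := hdvd
  have hlcm0 : Nat.lcm e n₀ ≠ 0 := Nat.lcm_ne_zero he0 h00
  have hQ0 : Q ≠ 0 := fun h => hlcm0 (by rw [hQ, h, mul_zero])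
  have h01 : n₀ * n₁ ≠ 0 := fun h => hlcm0 (by rw [hQ, h, zero_mul])
  rw [hQ, Nat.mul_div_cancel_left _ (Nat.pos_of_ne_zero h01)] at h'
  obtain ⟨c, rfl⟩ := exists_eq_pow_mul_of_isGreatest hp hQ0 h'
  have h2 : Nat.lcm e n₀ = p ^ a * Nat.lcm N n₀ := by
    rw [he]
    have hc : Nat.Coprime (p ^ a) n₀ := (hp.coprime_iff_not_dvd.mpr h₀.1.2).pow_left a
    rw [Nat.lcm, Nat.lcm, Nat.Coprime.gcd_mul_left_cancel N hc, mul_assoc,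
      Nat.mul_div_assoc _ ((Nat.gcd_dvd_left N n₀).mul_right n₀)]
  have h3 : ¬ p ∣ Nat.lcm N n₀ := fun h =>
    (hp.dvd_mul.mp (h.trans (Nat.lcm_dvd_mul _ _))).elim hN h₀.1.2
  have h4 : ¬ p ∣ n₁ * (n₀ * m') := fun h =>
    (hp.dvd_mul.mp h).elim h₁.1.2.1 fun h => (hp.dvd_mul.mp h).elim h₀.1.2 h'.1.2
  refine eq_of_pow_mul_eq_pow_mul (a := a) (b := c) hp h3 h4 ?_
  rw [← h2, hQ]
  ring

/-- A prime divisor `q` of `m'` not dividing `n₀` could be absorbed into `n₁`, contradicting the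
maximality of `n₁`. -/
theorem prime_dvd_of_isGreatest {q : ℕ} (hq : q.Prime) (hqm : q ∣ m') : q ∣ n₀ := by
  by_contra hqn
  have hL := lcm_eq_mul_of_isGreatest hp he hN h₀ h₁ h'
  have hcop : Nat.Coprime (n₁ * q) n₀ :=
    Nat.Coprime.mul_left h₁.1.2.2 (hq.coprime_iff_not_dvd.mpr hqn)
  have h1 : n₁ * q ∣ N := by
    refine hcop.dvd_of_dvd_mul_right (Dvd.dvd.trans ?_ (Nat.lcm_dvd_mul N n₀))
    rw [hL]
    exact mul_dvd_mul_left _ (hqm.mul_left _)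
  have h2 : n₁ * q ≤ n₁ :=
    h₁.2 ⟨h1.trans (he ▸ dvd_mul_left _ _), fun h => hN (h.trans h1), hcop⟩
  have h3 : 0 < n₁ := Nat.pos_of_ne_zero fun h => h₁.1.2.1 (h ▸ dvd_zero p)
  have := hq.two_le
  nlinarith

include hn in
/-- Dividing by `φ(n)`, the left side says `φ(n₁) m' = ord_N (p ^ f)` with `f = ord_{n₀} p`. After
multiplying by `f` it becomes `φ(n₁) · m' f = lcm (ord_{n₁} p) (ord_{n₀ m'} p)`, where the two
orders divide `φ(n₁)` and `m' f` respectively. -/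
theorem totient_lcm_eq_iff :
    Nat.totient (Nat.lcm n N) = ordMod N (p ^ ordMod n₀ p) * Nat.totient n ↔
      ordMod n₁ p = Nat.totient n₁ ∧ ordMod (n₀ * m') p = m' * ordMod n₀ p ∧
        Nat.gcd (ordMod n₁ p) (ordMod (n₀ * m') p) = 1 := by
  have h00 : n₀ ≠ 0 := fun h => h₀.1.2 (h ▸ dvd_zero p)
  have h10 : n₁ ≠ 0 := fun h => h₁.1.2.1 (h ▸ dvd_zero p)
  have hm0 : m' ≠ 0 := fun h => h'.1.2 (h ▸ dvd_zero p)
  have hL := lcm_eq_mul_of_isGreatest hp he hN h₀ h₁ h'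
  have hq := fun q => prime_dvd_of_isGreatest (q := q) hp he hN h₀ h₁ h'
  have hc0 : Nat.Coprime p n₀ := hp.coprime_iff_not_dvd.mpr h₀.1.2
  have hc1 : Nat.Coprime p n₁ := hp.coprime_iff_not_dvd.mpr h₁.1.2.1
  have hcm : Nat.Coprime n₁ (n₀ * m') := by
    refine Nat.Coprime.mul_right h₁.1.2.2 (Nat.coprime_of_dvd fun q hqp hq1 hqm => ?_)
    exact hqp.not_dvd_one (h₁.1.2.2 ▸ Nat.dvd_gcd hq1 (hq q hqp hqm))
  have hf : 0 < ordMod n₀ p := ordMod_pos h00 hc0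
  obtain ⟨b, hb⟩ := exists_eq_pow_mul_of_isGreatest hp hn h₀
  have hlcm : Nat.lcm n N = p ^ b * (n₁ * (n₀ * m')) := by
    rw [← hL, Nat.lcm_comm N n₀, hb]
    have hc : Nat.Coprime (p ^ b) N := (hp.coprime_iff_not_dvd.mpr hN).pow_left b
    rw [Nat.lcm, Nat.lcm, Nat.Coprime.gcd_mul_left_cancel n₀ hc, mul_assoc,
      Nat.mul_div_assoc _ ((Nat.gcd_dvd_left n₀ N).mul_right N)]
  have hcb : Nat.Coprime (p ^ b) (n₁ * (n₀ * m')) :=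
    (Nat.Coprime.mul_right hc1 (Nat.Coprime.mul_right hc0
      (hp.coprime_iff_not_dvd.mpr h'.1.2))).pow_left b
  have ht0 : 0 < Nat.totient n₀ := Nat.totient_pos.mpr (Nat.pos_of_ne_zero h00)
  have htb : 0 < Nat.totient (p ^ b) := Nat.totient_pos.mpr (pow_pos hp.pos b)
  have hord : ordMod N (p ^ ordMod n₀ p) * ordMod n₀ p =
      Nat.lcm (ordMod n₁ p) (ordMod (n₀ * m') p) := by
    rw [ordMod_pow_mul hf, hL, ← hcm.lcm_eq_mul, ordMod_lcm]
  rw [← mul_eq_lcm_iff (ordMod_dvd_totient hc1) (ordMod_mul_dvd m' hq)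
    (Nat.totient_pos.mpr (Nat.pos_of_ne_zero h10)) (Nat.mul_pos (Nat.pos_of_ne_zero hm0) hf),
    ← hord, hlcm, Nat.totient_mul hcb, Nat.totient_mul hcm, totient_mul_of_forall_prime_dvd m' hq]
  conv_lhs => rw [hb, Nat.totient_mul (hc0.pow_left b)]
  rw [← mul_assoc (Nat.totient n₁) m' (ordMod n₀ p), Nat.mul_left_inj hf.ne']
  rw [show (p ^ b).totient * (n₁.totient * (m' * n₀.totient)) =
    n₁.totient * m' * ((p ^ b).totient * n₀.totient) by ring,
    Nat.mul_left_inj (Nat.mul_pos htb ht0).ne']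

end

/-! ### Group rings over integrally closed local domains -/

section GroupRing

open Polynomial

variable {R : Type*} [CommRing R] [IsIntegrallyClosed R]
  (K : Type*) [Field K] [Algebra R K] [IsFractionRing R K]
  {E : Type*} [Field E] [Algebra R E] [Algebra K E] [IsScalarTower R K E]

/-- The Galois group of the cyclotomic extension preserves `R[ζ]`; its invariants there are integral
over `R` and lie in `K`, hence in `R`. -/
theorem exists_algebraMap_eq_of_forall_algEquiv_adjoin {N : ℕ} [NeZero N]
    [IsCyclotomicExtension {N} K E] {ζ : E} (hζ : IsPrimitiveRoot ζ N)
    (s : Algebra.adjoin R {ζ})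
    (hs : ∀ σ : Algebra.adjoin R {ζ} ≃ₐ[R] Algebra.adjoin R {ζ}, σ s = s) :
    ∃ r, algebraMap R (Algebra.adjoin R {ζ}) r = s := by
  have hgal : IsGalois K E := IsCyclotomicExtension.isGalois {N} K E
  have hfin : FiniteDimensional K E := IsCyclotomicExtension.finiteDimensional {N} K E
  have hstab : ∀ (τ : E ≃ₐ[K] E) (x : Algebra.adjoin R {ζ}),
      (τ : E ≃ₐ[K] E) x ∈ Algebra.adjoin R {ζ} := by
    rintro τ ⟨x, hx⟩
    obtain ⟨i, -, hi⟩ := hζ.eq_pow_of_pow_eq_one (ξ := τ ζ)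
      (by rw [← map_pow, hζ.pow_eq_one, map_one])
    rw [Algebra.adjoin_singleton_eq_range_aeval] at hx
    obtain ⟨P, rfl⟩ := hx
    have h1 : τ (aeval ζ P) = aeval (τ ζ) P := by
      have := Polynomial.aeval_algHom_apply ((τ : E →ₐ[K] E).restrictScalars R) ζ P
      exact this.symm
    change τ (aeval ζ P) ∈ _
    rw [h1, ← hi]
    have h2 := Subalgebra.aeval_coe (Algebra.adjoin R {ζ})
      ⟨ζ ^ i, pow_mem (Algebra.self_mem_adjoin_singleton R ζ) i⟩ P
    exact h2 ▸ SetLike.coe_mem _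
  have hfix : ∀ τ : E ≃ₐ[K] E, τ s = s := by
    intro τ
    let φ : (E ≃ₐ[K] E) → (Algebra.adjoin R {ζ} →ₐ[R] Algebra.adjoin R {ζ}) := fun τ =>
      (((τ : E →ₐ[K] E).restrictScalars R).comp (Algebra.adjoin R {ζ}).val).codRestrict _ (hstab τ)
    have hφ : ∀ τ x, ((φ τ x : Algebra.adjoin R {ζ}) : E) = τ x := fun _ _ => rfl
    let σ : Algebra.adjoin R {ζ} ≃ₐ[R] Algebra.adjoin R {ζ} :=
      AlgEquiv.ofAlgHom (φ τ) (φ τ.symm)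
        (AlgHom.ext fun x => Subtype.ext (by
          rw [AlgHom.comp_apply, hφ, hφ, AlgEquiv.apply_symm_apply]; rfl))
        (AlgHom.ext fun x => Subtype.ext (by
          rw [AlgHom.comp_apply, hφ, hφ, AlgEquiv.symm_apply_apply]; rfl))
    exact congrArg Subtype.val (hs σ)
  obtain ⟨k, hk⟩ := (IsGalois.mem_range_algebraMap_iff_fixed (F := K) (s : E)).mpr hfix
  have hζint : IsIntegral R ζ := (hζ.isIntegral (NeZero.pos N)).tower_top
  have hsint : IsIntegral R (s : E) := by
    have : Algebra.IsIntegral R (Algebra.adjoin R {ζ}) :=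
      Algebra.IsIntegral.adjoin (by simpa using hζint)
    exact (Algebra.IsIntegral.isIntegral (R := R) s).map (Algebra.adjoin R {ζ}).val
  rw [← hk, isIntegral_algebraMap_iff (algebraMap K E).injective] at hsint
  obtain ⟨r, hr⟩ := IsIntegrallyClosed.isIntegral_iff.mp hsint
  refine ⟨r, Subtype.ext ?_⟩
  rw [← hk, ← hr, ← IsScalarTower.algebraMap_apply R K E]
  rfl

/-- Let `R` be an integrally closed local domain with finite residue field of cardinality `p ^ f`,
and let `N` be the prime-to-`p` part of the exponent of `G`. Then `R[G]` is clean exactly when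
the `N`-th cyclotomic extension of the fraction field of `R` has the same degree as that of the
residue field. -/
theorem isCleanRing_monoidAlgebra_iff_natDegree [IsDomain R] [IsLocalRing R] {p f a N : ℕ}
    (hp : p.Prime) (hcard : Nat.card (IsLocalRing.ResidueField R) = p ^ f) (hpN : ¬ p ∣ N)
    [IsCyclotomicExtension {N} K E] {ζ : E} (hζ : IsPrimitiveRoot ζ N)
    {G : Type*} [CommGroup G] [Finite G] (hexp : Monoid.exponent G = p ^ a * N) :
    IsCleanRing (MonoidAlgebra R G) ↔
      (minpoly K ζ).natDegree = orderOf ((p ^ f : ℕ) : ZMod N) := by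
  have hN0 : N ≠ 0 := fun h => hpN (h ▸ dvd_zero p)
  have : NeZero N := ⟨hN0⟩
  have hinj : Function.Injective (algebraMap R E) := by
    rw [IsScalarTower.algebraMap_eq R K E]
    exact (algebraMap K E).injective.comp (IsFractionRing.injective R K)
  have hfaith : FaithfulSMul R E := (faithfulSMul_iff_algebraMap_injective R E).mpr hinj
  have htf : Module.IsTorsionFree R E := inferInstance
  rw [← isLocalRing_adjoin_iff_natDegree K hp hcard hpN hζ]
  constructor
  · intro h
    have h1 := h.adjoin_of_monoidAlgebra hexp hN0 hζ
    exact h1.isLocalRing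
  · intro hloc
    have hζint : IsIntegral R ζ := (hζ.isIntegral (NeZero.pos N)).tower_top
    have : Algebra.IsIntegral R (Algebra.adjoin R {ζ}) :=
      Algebra.IsIntegral.adjoin (by simpa using hζint)
    have hpR : (p : R) ∈ IsLocalRing.maximalIdeal R := by
      rw [← IsLocalRing.residue_eq_zero_iff, map_natCast]
      have : Finite (IsLocalRing.ResidueField R) :=
        Nat.finite_of_card_ne_zero (by rw [hcard]; exact pow_ne_zero _ hp.ne_zero)
      let _ := Fintype.ofFinite (IsLocalRing.ResidueField R)
      have : Fact p.Prime := ⟨hp⟩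
      have : CharP (IsLocalRing.ResidueField R) p :=
        charP_of_card_eq_prime_pow (by rw [← Nat.card_eq_fintype_card, hcard])
      exact CharP.cast_eq_zero _ p
    have hpS : (p : Algebra.adjoin R {ζ}) ∈ IsLocalRing.maximalIdeal (Algebra.adjoin R {ζ}) := by
      have hmax : ((IsLocalRing.maximalIdeal (Algebra.adjoin R {ζ})).comap
          (algebraMap R (Algebra.adjoin R {ζ}))).IsMaximal :=
        Ideal.isMaximal_comap_of_isIntegral_of_isMaximal _
      rw [← IsLocalRing.eq_maximalIdeal hmax, Ideal.mem_comap, map_natCast] at hpR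
      exact hpR
    have hζ' : IsPrimitiveRoot
        (⟨ζ, Algebra.self_mem_adjoin_singleton R ζ⟩ : Algebra.adjoin R {ζ}) N :=
      IsPrimitiveRoot.of_map_of_injective (f := (Algebra.adjoin R {ζ}).val) hζ
        Subtype.val_injective
    refine isCleanRing_monoidAlgebra_of_isLocalRing ?_
      (exists_algebraMap_eq_of_forall_algEquiv_adjoin K hζ) hp hpN hexp hpS hζ'
    intro x y hxy
    exact hinj (congrArg Subtype.val hxy)

end GroupRing

/-! ### Cyclotomic fields -/

section Cyclotomic

open NumberField

/-- The compositum of the `n`-th and the `N`-th cyclotomic fields is the `lcm n N`-th one. -/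
theorem natDegree_minpoly_mul_totient (n N : ℕ) [NeZero n] [NeZero N] (K : Type*) [Field K]
    [NumberField K] [IsCyclotomicExtension {n} ℚ K] {E : Type*} [Field E] [CharZero E] [Algebra K E]
    [IsCyclotomicExtension {N} K E] {ζ : E} (hζ : IsPrimitiveRoot ζ N) :
    (minpoly K ζ).natDegree * Nat.totient n = Nat.totient (Nat.lcm n N) := by
  have hlcm : NeZero (Nat.lcm n N) := ⟨Nat.lcm_ne_zero (NeZero.ne n) (NeZero.ne N)⟩
  have h1 : IsCyclotomicExtension ({n} ∪ {N}) ℚ E :=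
    IsCyclotomicExtension.trans {n} {N} ℚ K E (algebraMap K E).injective
  have hn : IsPrimitiveRoot (algebraMap K E (IsCyclotomicExtension.zeta n ℚ K)) n :=
    (IsCyclotomicExtension.zeta_spec n ℚ K).map_of_injective (algebraMap K E).injective
  have h2 : IsCyclotomicExtension ({n} ∪ {N} ∪ {Nat.lcm n N}) ℚ E :=
    IsCyclotomicExtension.union_of_isPrimitiveRoot _ ℚ E
      (hn.pow_mul_pow_lcm hζ (NeZero.ne n) (NeZero.ne N))
  have h3 : IsCyclotomicExtension {Nat.lcm n N} ℚ E := by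
    rw [IsCyclotomicExtension.iff_union_of_dvd (n := n) ℚ E
        ⟨Nat.lcm n N, Set.mem_singleton _, hlcm.ne, Nat.dvd_lcm_left n N⟩,
      IsCyclotomicExtension.iff_union_of_dvd (n := N) ℚ E
        ⟨Nat.lcm n N, Or.inl (Set.mem_singleton _), hlcm.ne, Nat.dvd_lcm_right n N⟩]
    have hset : ({Nat.lcm n N} ∪ {n} ∪ {N} : Set ℕ) = {n} ∪ {N} ∪ {Nat.lcm n N} := by
      rw [Set.union_comm, Set.union_comm {Nat.lcm n N}, ← Set.union_assoc,
        Set.union_comm {N} {n}]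
    rwa [hset]
  have hE := IsCyclotomicExtension.finrank (n := Nat.lcm n N) E
    (Polynomial.cyclotomic.irreducible_rat (NeZero.pos (Nat.lcm n N)))
  have hK := IsCyclotomicExtension.finrank (n := n) K
    (Polynomial.cyclotomic.irreducible_rat (NeZero.pos n))
  have hd : (minpoly K ζ).natDegree = Module.finrank K E := by
    rw [(hζ.powerBasis K).finrank, ← (hζ.powerBasis K).natDegree_minpoly,
      IsPrimitiveRoot.powerBasis_gen]
  rw [← hE, ← hK, hd, mul_comm, Module.finrank_mul_finrank]

/-- The residue degree of a prime of `ℚ(ζ_n)` above `p` is the order of `p` modulo the prime-to-`p`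
part of `n`. -/
theorem natCard_residueField_localization_atPrime (n : ℕ) [NeZero n] (K : Type*) [Field K]
    [NumberField K] [IsCyclotomicExtension {n} ℚ K] (P : Ideal (𝓞 K)) [P.IsPrime] (hP : P ≠ ⊥)
    {p n₀ : ℕ} (hp : p.Prime) (hunder : P.under ℤ = Ideal.span {(p : ℤ)})
    (h₀ : IsGreatest {d : ℕ | d ∣ n ∧ ¬ p ∣ d} n₀) :
    Nat.card (IsLocalRing.ResidueField (Localization.AtPrime P)) = p ^ ordMod n₀ p := by
  have : Fact p.Prime := ⟨hp⟩
  have hmax : P.IsMaximal := Ideal.IsPrime.isMaximal inferInstance hP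
  have hover : P.LiesOver (Ideal.span {(p : ℤ)}) := ⟨hunder.symm⟩
  have hpmax : (Ideal.span {(p : ℤ)}).IsMaximal :=
    (Ideal.IsPrime.isMaximal ((Ideal.span_singleton_prime (by exact_mod_cast hp.ne_zero)).mpr
      (Nat.prime_iff_prime_int.mp hp)) (by simpa using hp.ne_zero))
  have h1 : Nat.card (IsLocalRing.ResidueField (Localization.AtPrime P)) = Ideal.absNorm P :=
    Nat.card_congr (IsLocalization.AtPrime.equivQuotMaximalIdeal P
      (Localization.AtPrime P)).symm.toEquiv
  have h2 : P.inertiaDeg ℤ = ordMod n₀ p := by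
    obtain ⟨b, hb⟩ := exists_eq_pow_mul_of_isGreatest hp (NeZero.ne n) h₀
    rcases b with _ | k
    · rw [pow_zero, one_mul] at hb
      subst hb
      exact IsCyclotomicExtension.Rat.inertiaDeg_eq_of_not_dvd p K P h₀.1.2
    · exact IsCyclotomicExtension.Rat.inertiaDeg_eq n K P hb h₀.1.2
  rw [h1, Ideal.absNorm_eq_pow_inertiaDeg' P hp, Ideal.inertiaDeg'_eq_inertiaDeg, h2]

theorem isCleanRing_localization_atPrime_iff (n : ℕ) [NeZero n] (K : Type*) [Field K]
    [NumberField K] [IsCyclotomicExtension {n} ℚ K] (P : Ideal (𝓞 K)) [P.IsPrime] (hP : P ≠ ⊥)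
    (G : Type*) [CommGroup G] [Finite G]
    {p a N n₀ : ℕ} (hp : p.Prime) (hunder : P.under ℤ = Ideal.span {(p : ℤ)})
    (hpN : ¬ p ∣ N) (hexp : Monoid.exponent G = p ^ a * N)
    (h₀ : IsGreatest {d : ℕ | d ∣ n ∧ ¬ p ∣ d} n₀) :
    IsCleanRing (MonoidAlgebra (Localization.AtPrime P) G) ↔
      Nat.totient (Nat.lcm n N) = ordMod N (p ^ ordMod n₀ p) * Nat.totient n := by
  have hN0 : N ≠ 0 := fun h => hpN (h ▸ dvd_zero p)
  have : NeZero N := ⟨hN0⟩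
  let _ : Algebra (Localization.AtPrime P) K :=
    IsLocalization.localizationAlgebraOfSubmonoidLe (Localization.AtPrime P) K P.primeCompl
      (nonZeroDivisors (𝓞 K)) P.primeCompl_le_nonZeroDivisors
  have : IsScalarTower (𝓞 K) (Localization.AtPrime P) K :=
    IsLocalization.localization_isScalarTower_of_submonoid_le (Localization.AtPrime P) K
      P.primeCompl (nonZeroDivisors (𝓞 K)) P.primeCompl_le_nonZeroDivisors
  have : IsFractionRing (Localization.AtPrime P) K :=
    IsFractionRing.isFractionRing_of_isDomain_of_isLocalization P.primeCompl
      (Localization.AtPrime P) K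
  have hζ := IsCyclotomicExtension.zeta_spec N K (CyclotomicField N K)
  rw [isCleanRing_monoidAlgebra_iff_natDegree K hp
    (natCard_residueField_localization_atPrime n K P hP hp hunder h₀) hpN hζ hexp,
    ← natDegree_minpoly_mul_totient n N K hζ,
    Nat.mul_left_inj (Nat.totient_pos.mpr (NeZero.pos n)).ne']
  rfl

end Cyclotomic

theorem theorem1p1 (n : ℕ) [NeZero n]
    (K : Type*) [Field K] [NumberField K] [IsCyclotomicExtension {n} ℚ K]
    (𝔭 : Ideal (NumberField.RingOfIntegers K)) [𝔭.IsPrime] (h𝔭 : 𝔭 ≠ ⊥)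
    (G : Type*) [CommGroup G] [Finite G] :
    (∀ p n₀ n₁ m' : ℕ, p.Prime →
      𝔭.under ℤ = Ideal.span {(p : ℤ)} →
      IsGreatest {d : ℕ | d ∣ n ∧ ¬ p ∣ d} n₀ →
      IsGreatest {d : ℕ | d ∣ Monoid.exponent G ∧ ¬ p ∣ d ∧ Nat.gcd d n₀ = 1} n₁ →
      IsGreatest {d : ℕ | d ∣ Nat.lcm (Monoid.exponent G) n₀ / (n₀ * n₁) ∧ ¬ p ∣ d} m' →
      (IsCleanRing (MonoidAlgebra (Localization.AtPrime 𝔭) G) ↔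
        ordMod n₁ p = Nat.totient n₁ ∧
        ordMod (n₀ * m') p = m' * ordMod n₀ p ∧
        Nat.gcd (ordMod n₁ p) (ordMod (n₀ * m') p) = 1)) ∧
    (Monoid.exponent G ∣ n → IsCleanRing (MonoidAlgebra (Localization.AtPrime 𝔭) G)) := by
  constructor
  · intro p n₀ n₁ m' hp hunder h₀ h₁ h'
    obtain ⟨a, N, hpN, hexp⟩ := Nat.exists_eq_pow_mul_and_not_dvd
      (Monoid.exponent_ne_zero_of_finite (G := G)) p hp.ne_one
    rw [isCleanRing_localization_atPrime_iff n K 𝔭 h𝔭 G hp hunder hpN hexp h₀]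
    exact totient_lcm_eq_iff hp (NeZero.ne n) hexp hpN h₀ h₁ h'
  · intro hdvd
    obtain ⟨p, hp, hunder⟩ : ∃ p : ℕ, p.Prime ∧ 𝔭.under ℤ = Ideal.span {(p : ℤ)} := by
      have h0 : 𝔭.under ℤ ≠ ⊥ := fun h => h𝔭 (Ideal.eq_bot_of_comap_eq_bot h)
      obtain ⟨g, hg⟩ := (IsPrincipalIdealRing.principal (𝔭.under ℤ)).principal
      refine ⟨g.natAbs, ?_, ?_⟩
      · rw [← Int.prime_iff_natAbs_prime]
        have hg0 : g ≠ 0 := by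
          rintro rfl
          exact h0 (by rw [hg]; simp)
        rw [← Ideal.span_singleton_prime hg0]
        have : (𝔭.under ℤ).IsPrime := inferInstance
        rw [hg] at this
        exact this
      · rw [Int.span_natAbs]
        exact hg
    obtain ⟨b, n₀, hpn₀, hn⟩ := Nat.exists_eq_pow_mul_and_not_dvd (NeZero.ne n) p hp.ne_one
    have h₀ : IsGreatest {d : ℕ | d ∣ n ∧ ¬ p ∣ d} n₀ := by
      refine ⟨⟨hn ▸ dvd_mul_left _ _, hpn₀⟩, fun d hd => ?_⟩
      refine Nat.le_of_dvd (Nat.pos_of_ne_zero fun h => hpn₀ (h ▸ dvd_zero p)) ?_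
      exact ((hp.coprime_iff_not_dvd.mpr hd.2).pow_left b).symm.dvd_of_dvd_mul_left (hn ▸ hd.1)
    obtain ⟨a, N, hpN, hexp⟩ := Nat.exists_eq_pow_mul_and_not_dvd
      (Monoid.exponent_ne_zero_of_finite (G := G)) p hp.ne_one
    rw [isCleanRing_localization_atPrime_iff n K 𝔭 h𝔭 G hp hunder hpN hexp h₀]
    -- `N` divides `n₀`, so `p ^ ord` is already `1` modulo `N` and no extension is needed
    have hNn : N ∣ n := (Dvd.intro_left _ hexp.symm).trans hdvd
    have hNn₀ : N ∣ n₀ :=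
      ((hp.coprime_iff_not_dvd.mpr hpN).pow_left b).symm.dvd_of_dvd_mul_left (hn ▸ hNn)
    have h1 : ordMod N (p ^ ordMod n₀ p) = 1 := by
      rw [← Nat.dvd_one, ordMod_dvd_iff, pow_one]
      exact ((ordMod_dvd_iff n₀ p _).mp dvd_rfl).of_dvd hNn₀
    rw [h1, one_mul, Nat.lcm_eq_left hNn]
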